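/- Let $G$ be a totally disconnected locally compact group and let $X$ be a totally disconnected compact (Hausdorff) space equipped with a continuous faithful action of $G$. For a clopen subset $\alpha\subseteq X$ let $R_G(\alpha)=\mathrm{Fix}_G(X\setminus\alpha)$ be the rigid stabilizer of $\alpha$, i.e. the pointwise fixator of $X\setminus\alpha$; it acts on $\alpha$. Suppose that the action of $G$ on $X$ is piecewise minimal-strongly-proximal, that is, for every non-empty clopen $\alpha\subseteq X$ the action of $R_G(\alpha)$ on $\alpha$ is minimal (every orbit is dense) and strongly proximal (for every regular Borel probability measure $\mu$ on $\alpha$, the weak-$*$ closure of the orbit $R_G(\alpha)\mu$ contains a Dirac measure). Let $\mathcal S_X$ be the set of closed subgroups $H\leq G$ such that, for every non-empty clopen $\alpha\subseteq X$, the setwise stabilizer $\{h\in H : h\alpha=\alpha\}$ of $\alpha$ in $H$ fixes a regular Borel probability measure on $\alpha$. A closed subgroup $H\leq G$ is called confined if the closure of its conjugacy class in the Chabauty space of closed subgroups of $G$ does not contain the trivial subgroup $\{e\}$, and relatively amenable if it fixes a regular Borel probability measure on every non-empty compact Hausdorff space with a continuous $G$-action. Then no subgroup $H\in\mathcal S_X$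 is confined. Moreover, $\mathcal S_X$ contains every relatively amenable closed subgroup of $G$. -/

import Mathlib

open MeasureTheory Set
open scoped Pointwise

universe u v w

namespace TDLC

/-! ### The Chabauty space and confined subgroups -/

/-- The Chabauty topology on the set of closed subgroups of `G`: it is generated by the sets
`{H | H ∩ C = ∅}` with `C` compact and the sets `{H | H ∩ V ≠ ∅}` with `V` open. -/
instance chabautyTopology (G : Type u) [Group G] [TopologicalSpace G] :
    TopologicalSpace (ClosedSubgroup G) :=
  TopologicalSpace.generateFrom
    ({S | ∃ C : Set G, IsCompact C ∧ S = {H : ClosedSubgroup G | (H : Set G) ∩ C = ∅}} ∪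
      {S | ∃ V : Set G, IsOpen V ∧ S = {H : ClosedSubgroup G | ((H : Set G) ∩ V).Nonempty}})

/-- The conjugacy class `{g H g⁻¹ | g ∈ G}` of a closed subgroup `H`. -/
def conjClass {G : Type u} [Group G] [TopologicalSpace G] (H : ClosedSubgroup G) :
    Set (ClosedSubgroup G) :=
  {K | ∃ g : G, (K : Set G) = (fun h : G => g * h * g⁻¹) '' (H : Set G)}

/-- `H` is confined if the Chabauty closure of its conjugacy class does not contain the trivial
subgroup. -/
def IsConfined {G : Type u} [Group G] [TopologicalSpace G] (H : ClosedSubgroup G) : Prop :=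
  ∀ K ∈ closure (conjClass H), (K : Set G) ≠ {1}

/-! ### Invariant probability measures and strong proximality -/

/-- The action of `Γ` on `Y` fixes some regular Borel probability measure on `Y`. -/
def FixesProbability (Γ : Type u) (Y : Type v) [Group Γ] [MulAction Γ Y]
    [TopologicalSpace Y] [MeasurableSpace Y] : Prop :=
  ∃ μ : Measure Y, IsProbabilityMeasure μ ∧ μ.Regular ∧ SMulInvariantMeasure Γ Y μ

/-- The action of `Γ` on `Y` is strongly proximal: the weak-* closure of the orbit of every
regular Borel probability measure on `Y` contains a Dirac measure. -/
def IsStronglyProximal (Γ : Type u) (Y : Type v) [Group Γ] [MulAction Γ Y]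
    [TopologicalSpace Y] [MeasurableSpace Y] [BorelSpace Y] : Prop :=
  ∀ μ : ProbabilityMeasure Y, (μ : Measure Y).Regular →
    ∃ y : Y, diracProba y ∈ closure
      {ν : ProbabilityMeasure Y | ∃ g : Γ, (ν : Measure Y) = (μ : Measure Y).map (fun z => g • z)}

/-! ### Rigid stabilizers -/

/-- The rigid stabilizer of `α`: the pointwise fixator of the complement of `α`. -/
def rigidStabilizer (G : Type u) {X : Type v} [Group G] [MulAction G X] (α : Set X) :
    Subgroup G :=
  fixingSubgroup G αᶜ

theorem rigidStabilizer_smul_mem {G : Type u} {X : Type v} [Group G] [MulAction G X]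
    {α : Set X} (g : rigidStabilizer G α) {x : X} (hx : x ∈ α) : (g : G) • x ∈ α := by
  by_contra h
  have h2 := (mem_fixingSubgroup_iff G).1 g.2 ((g : G) • x) h
  have h3 := MulAction.injective (g : G) h2
  exact h (by rwa [h3])

/-- The action of the rigid stabilizer of `α` on `α`, by restriction of the action on `X`. -/
instance rigidStabilizerAction (G : Type u) {X : Type v} [Group G] [MulAction G X] (α : Set X) :
    MulAction (rigidStabilizer G α) α where
  smul g x := ⟨(g : G) • (x : X), rigidStabilizer_smul_mem g x.2⟩
  one_smul x := Subtype.ext (one_smul G (x : X))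
  mul_smul g h x := Subtype.ext (mul_smul (g : G) (h : G) (x : X))

/-- The action of `G` on `X` is piecewise minimal-strongly-proximal: for every non-empty clopen
`α`, the action of the rigid stabilizer of `α` on `α` is minimal and strongly proximal. -/
def IsPiecewiseMinimalStronglyProximal (G : Type u) (X : Type v) [Group G] [MulAction G X]
    [TopologicalSpace X] [MeasurableSpace X] [BorelSpace X] : Prop :=
  ∀ α : Set X, IsClopen α → α.Nonempty →
    MulAction.IsMinimal (rigidStabilizer G α) α ∧ IsStronglyProximal (rigidStabilizer G α) α

/-! ### The class `𝒮_X` and relatively amenable subgroups -/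

/-- The class `𝒮_X` of closed subgroups `H` of `G` such that for every non-empty clopen `α ⊆ X`
the (setwise) stabilizer of `α` in `H` fixes a probability measure on `α`. -/
def classS (G : Type u) (X : Type v) [Group G] [TopologicalSpace G] [MulAction G X]
    [TopologicalSpace X] [MeasurableSpace X] : Set (ClosedSubgroup G) :=
  {H | ∀ α : Set X, IsClopen α → α.Nonempty →
    FixesProbability (MulAction.stabilizer H.toSubgroup α) α}

/-- A closed subgroup `H` is relatively amenable in `G` if it fixes a probability measure on every
non-empty compact (Hausdorff) `G`-space. -/
def IsRelativelyAmenable {G : Type u} [Group G] [TopologicalSpace G]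
    (H : ClosedSubgroup G) : Prop :=
  ∀ (Y : Type w) [TopologicalSpace Y] [CompactSpace Y] [T2Space Y] [Nonempty Y]
    [MulAction G Y] [ContinuousSMul G Y] [MeasurableSpace Y] [BorelSpace Y],
    FixesProbability H.toSubgroup Y

end TDLC

/-! Every Chabauty neighbourhood of the trivial subgroup contains all closed subgroups avoiding some
compact `C` with `1 ∉ C`, so it suffices to conjugate `H` off any such `C`. Membership in `classS`
gives an `H`-equivariant family of measures `μ γ`, one on each non-empty clopen `γ`
(`exists_isMeasureFamily`); its translate by `g` is equivariant under `gHg⁻¹`. Minimality and strong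
proximality let an element of the rigid stabilizer of `γ` put more than half of `μ γ` on a
prescribed clopen `a ⊆ γ`. For a laminar list of pairs `(γ, a)` later moves preserve earlier sets,
so one `g` meets all requirements (`exists_translateFamily`).

With `U` a compact open subgroup, `C` is covered by finitely many sets of `k ∈ cU` displacing a
clopen `α`. The requirements are designed in `IsLaminar.exists_append` to exclude such `k` from
`gHg⁻¹`. Divide `X` into finitely many clopen cells permuted by `U`. If `k` sends a cell `A ⊆ α` to
some `β` disjoint from `A`, equivariance sends heavy sets to heavy sets, and two sets of mass above
one half meet; so the heavy sets in `A` and `β` dictate how `k` acts on finer cells. They are placed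
so that `k` would have to separate two points that every element of `cU` keeps together. Only
finitely many `β` occur.

A relatively amenable `H` fixes a measure on the product of all non-empty clopen sets, and
coordinate projections push it to each of them. -/

namespace TDLC

/-! ### Open stabilizers and van Dantzig's theorem. -/

section Topology

variable {G : Type u} {X : Type v} [Group G] [TopologicalSpace G] [TopologicalSpace X]
  [MulAction G X] [ContinuousSMul G X]

theorem isOpen_setOf_forall_smul_mem {K V : Set X} (hK : IsCompact K) (hV : IsOpen V) :
    IsOpen {g : G | ∀ x ∈ K, g • x ∈ V} := by
  rw [isOpen_iff_eventually]
  intro g hg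
  refine hK.eventually_forall_of_forall_eventually fun x hx => ?_
  exact (continuous_smul (M := G) (X := X)).continuousAt.eventually (hV.mem_nhds (hg x hx))

theorem isOpen_stabilizer_of_isCompact_of_isOpen [IsTopologicalGroup G] {α : Set X}
    (hα : IsCompact α) (hα' : IsOpen α) : IsOpen (MulAction.stabilizer G α : Set G) := by
  have h := isOpen_setOf_forall_smul_mem (G := G) hα hα'
  have h2 : (MulAction.stabilizer G α : Set G) =
      {g : G | ∀ x ∈ α, g • x ∈ α} ∩ (fun g => g⁻¹) ⁻¹' {g : G | ∀ x ∈ α, g • x ∈ α} := by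
    ext g
    simp only [SetLike.mem_coe, MulAction.mem_stabilizer_iff, mem_inter_iff, mem_ofPred_eq,
      mem_preimage]
    constructor
    · intro hg
      refine ⟨fun x hx => hg ▸ smul_mem_smul_set hx, fun x hx => ?_⟩
      rw [← mem_smul_set_iff_inv_smul_mem, hg]
      exact hx
    · rintro ⟨h1, h2⟩
      refine Subset.antisymm ?_ fun x hx => ?_
      · rintro _ ⟨x, hx, rfl⟩
        exact h1 x hx
      · exact mem_smul_set_iff_inv_smul_mem.2 (h2 x hx)
  rw [h2]
  exact h.inter (h.preimage continuous_inv)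

/-- The stabilizer of a compact open `W ∋ 1` under left translation is open, and lies in `W` because
it moves `1` within `W`. -/
theorem exists_isCompact_isOpen_subgroup (G : Type u) [Group G] [TopologicalSpace G]
    [IsTopologicalGroup G] [LocallyCompactSpace G] [TotallyDisconnectedSpace G] :
    ∃ U : Subgroup G, IsOpen (U : Set G) ∧ IsCompact (U : Set G) := by
  obtain ⟨N, hN, hN1⟩ := exists_compact_mem_nhds (1 : G)
  obtain ⟨W, hW, h1W, hWN⟩ := loc_compact_Haus_tot_disc_of_zero_dim.mem_nhds_iff.1 hN1
  have hWc : IsCompact W := hN.of_isClosed_subset hW.1 hWN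
  have hopen := isOpen_stabilizer_of_isCompact_of_isOpen (G := G) hWc hW.2
  refine ⟨MulAction.stabilizer G W, hopen,
    hWc.of_isClosed_subset (Subgroup.isClosed_of_isOpen _ hopen) fun g hg => ?_⟩
  have h : g • (1 : G) ∈ g • W := smul_mem_smul_set h1W
  rw [MulAction.mem_stabilizer_iff.1 hg] at h
  simpa using h

end Topology

/-! ### Cells of a `U`-invariant partition. -/

section Agree

variable {G : Type u} {X : Type v} [Group G] [MulAction G X]

/-- Two points agree if no translate by an element of `U` is separated by a set in `𝓢`. -/
def Agree (U : Subgroup G) (𝓢 : Set (Set X)) (x y : X) : Prop :=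
  ∀ u ∈ U, ∀ S ∈ 𝓢, (u • x ∈ S ↔ u • y ∈ S)

/-- The set of points agreeing with `x`. -/
def agreeClass (U : Subgroup G) (𝓢 : Set (Set X)) (x : X) : Set X := {y | Agree U 𝓢 x y}

variable {U : Subgroup G} {𝓢 : Set (Set X)} {x y z : X}

theorem Agree.refl (U : Subgroup G) (𝓢 : Set (Set X)) (x : X) : Agree U 𝓢 x x :=
  fun _ _ _ _ => Iff.rfl

theorem Agree.symm (h : Agree U 𝓢 x y) : Agree U 𝓢 y x :=
  fun u hu S hS => (h u hu S hS).symm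

theorem Agree.trans (h : Agree U 𝓢 x y) (h' : Agree U 𝓢 y z) : Agree U 𝓢 x z :=
  fun u hu S hS => (h u hu S hS).trans (h' u hu S hS)

theorem Agree.mono {𝓣 : Set (Set X)} (h : Agree U 𝓢 x y) (h𝓣 : 𝓣 ⊆ 𝓢) : Agree U 𝓣 x y :=
  fun u hu S hS => h u hu S (h𝓣 hS)

theorem Agree.mem_iff (h : Agree U 𝓢 x y) {S : Set X} (hS : S ∈ 𝓢) : x ∈ S ↔ y ∈ S := by
  simpa using h 1 U.one_mem S hS

theorem Agree.smul (h : Agree U 𝓢 x y) {w : G} (hw : w ∈ U) : Agree U 𝓢 (w • x) (w • y) := by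
  intro u hu S hS
  simpa [mul_smul] using h (u * w) (U.mul_mem hu hw) S hS

theorem mem_agreeClass_self (U : Subgroup G) (𝓢 : Set (Set X)) (x : X) : x ∈ agreeClass U 𝓢 x :=
  Agree.refl U 𝓢 x

theorem Agree.agreeClass_eq (h : Agree U 𝓢 x y) : agreeClass U 𝓢 x = agreeClass U 𝓢 y :=
  Set.ext fun _ => ⟨fun h' => h.symm.trans h', fun h' => h.trans h'⟩

theorem agreeClass_subset_or_disjoint {S : Set X} (hS : S ∈ 𝓢) :
    agreeClass U 𝓢 x ⊆ S ∨ Disjoint (agreeClass U 𝓢 x) S := by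
  by_cases hx : x ∈ S
  · exact Or.inl fun y hy => (Agree.mem_iff hy hS).1 hx
  · exact Or.inr (disjoint_left.2 fun y hy hyS => hx ((Agree.mem_iff hy hS).2 hyS))

theorem smul_agreeClass {w : G} (hw : w ∈ U) :
    w • agreeClass U 𝓢 x = agreeClass U 𝓢 (w • x) := by
  ext y
  rw [mem_smul_set_iff_inv_smul_mem]
  constructor
  · intro h
    have h' := Agree.smul h hw
    rwa [smul_inv_smul] at h'
  · intro h
    have h' := Agree.smul h (U.inv_mem hw)
    rwa [inv_smul_smul] at h'

/-- Since `U` permutes cells, every `k ∈ cU` sends cells to `c`-translates of cells; these again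
partition `X`. -/
theorem smul_agreeClass_of_coset {c k : G} (hk : c⁻¹ * k ∈ U) :
    k • agreeClass U 𝓢 x = c • agreeClass U 𝓢 ((c⁻¹ * k) • x) := by
  rw [← smul_agreeClass hk, smul_smul, mul_inv_cancel_left]

theorem smul_agreeClass_subset_or_disjoint {c k : G} (hk : c⁻¹ * k ∈ U) {S : Set X}
    (hS : c⁻¹ • S ∈ 𝓢) :
    k • agreeClass U 𝓢 x ⊆ S ∨ Disjoint (k • agreeClass U 𝓢 x) S := by
  rw [smul_agreeClass_of_coset hk]
  refine (agreeClass_subset_or_disjoint (U := U) (x := (c⁻¹ * k) • x) hS).imp (fun h => ?_) fun h => ?_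
  · exact smul_set_subset_iff_subset_inv_smul_set.2 h
  · rwa [← Set.disjoint_smul_set (a := c), smul_inv_smul] at h

theorem smul_agreeClass_eq_of_not_disjoint {c k k' : G} (hk : c⁻¹ * k ∈ U) (hk' : c⁻¹ * k' ∈ U)
    (h : ¬ Disjoint (k • agreeClass U 𝓢 x) (k' • agreeClass U 𝓢 y)) :
    k • agreeClass U 𝓢 x = k' • agreeClass U 𝓢 y := by
  rw [smul_agreeClass_of_coset hk, smul_agreeClass_of_coset hk', Set.disjoint_smul_set,
    not_disjoint_iff] at h
  obtain ⟨w, hw, hw'⟩ := h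
  rw [smul_agreeClass_of_coset hk, smul_agreeClass_of_coset hk',
    Agree.agreeClass_eq (Agree.trans hw (Agree.symm hw'))]

end Agree

/-! ### Cells are clopen and finite in number. -/

section Classes

variable {G : Type u} {X : Type v} [Group G] [TopologicalSpace G] [TopologicalSpace X]
  [MulAction G X] [ContinuousSMul G X] {U : Subgroup G} {𝓢 : Set (Set X)}

/-- For clopen `S` agreement at `u` persists for nearby points and nearby `u`; compactness of `U`
makes this uniform in `u`. -/
theorem isOpen_agreeClass (hU : IsCompact (U : Set G)) (h𝓢 : 𝓢.Finite)
    (hS : ∀ S ∈ 𝓢, IsClopen S) (x : X) : IsOpen (agreeClass U 𝓢 x) := by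
  have h1 : agreeClass U 𝓢 x = ⋂ S ∈ 𝓢, {y | ∀ u ∈ (U : Set G), (u • x ∈ S ↔ u • y ∈ S)} := by
    ext y
    simp only [agreeClass, Agree, mem_ofPred_eq, mem_iInter, SetLike.mem_coe]
    exact ⟨fun h S hS u hu => h u hu S hS, fun h u hu S hS => h S hS u hu⟩
  rw [h1]
  refine h𝓢.isOpen_biInter fun S hS' => ?_
  rw [isOpen_iff_eventually]
  intro y hy
  refine hU.eventually_forall_of_forall_eventually fun u hu => ?_
  have hc1 : Continuous fun q : X × G => q.2 • x := continuous_snd.smul continuous_const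
  have hc2 : Continuous fun q : X × G => q.2 • q.1 := continuous_snd.smul continuous_fst
  have hyu := hy u hu
  by_cases hx : u • x ∈ S
  · filter_upwards [hc1.continuousAt.eventually ((hS S hS').2.mem_nhds (x := u • x) hx),
      hc2.continuousAt.eventually ((hS S hS').2.mem_nhds (x := u • y) (hyu.1 hx))] with q h1 h2
    exact ⟨fun _ => h2, fun _ => h1⟩
  · filter_upwards [hc1.continuousAt.eventually
        ((hS S hS').compl.2.mem_nhds (x := u • x) hx),
      hc2.continuousAt.eventually ((hS S hS').compl.2.mem_nhds (x := u • y)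
        fun h => hx (hyu.2 h))] with q h1 h2
    exact ⟨fun h => absurd h h1, fun h => absurd h h2⟩

theorem isClopen_agreeClass (hU : IsCompact (U : Set G)) (h𝓢 : 𝓢.Finite)
    (hS : ∀ S ∈ 𝓢, IsClopen S) (x : X) : IsClopen (agreeClass U 𝓢 x) := by
  refine ⟨⟨?_⟩, isOpen_agreeClass hU h𝓢 hS x⟩
  rw [isOpen_iff_mem_nhds]
  intro y hy
  refine Filter.mem_of_superset ((isOpen_agreeClass hU h𝓢 hS y).mem_nhds
    (mem_agreeClass_self U 𝓢 y)) fun z hz hxz => hy ?_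
  exact Agree.trans hxz (Agree.symm hz)

theorem finite_range_agreeClass [CompactSpace X] (hU : IsCompact (U : Set G)) (h𝓢 : 𝓢.Finite)
    (hS : ∀ S ∈ 𝓢, IsClopen S) : (range (agreeClass U 𝓢 : X → Set X)).Finite := by
  obtain ⟨t, ht⟩ := isCompact_univ.elim_finite_subcover (agreeClass U 𝓢 : X → Set X)
    (isOpen_agreeClass hU h𝓢 hS) fun x _ => mem_iUnion.2 ⟨x, mem_agreeClass_self U 𝓢 x⟩
  refine (t.finite_toSet.image (agreeClass U 𝓢)).subset ?_
  rintro _ ⟨x, rfl⟩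
  obtain ⟨y, hy, hxy⟩ := mem_iUnion₂.1 (ht (mem_univ x))
  exact ⟨y, hy, Agree.agreeClass_eq hxy⟩

end Classes

/-! ### Concentration of mass and equivariant families of measures. -/

section Measures

theorem isClopen_smul {G : Type*} {X : Type*} [Group G] [TopologicalSpace X] [MulAction G X]
    [ContinuousConstSMul G X] {γ : Set X} (hγ : IsClopen γ) (g : G) : IsClopen (g • γ) :=
  ⟨hγ.1.smul g, hγ.2.smul g⟩

/-- The indicator of a clopen set is continuous, so its integral is weak-* continuous in the
measure. -/
theorem isOpen_setOf_lt_apply_of_isClopen {Y : Type*} [TopologicalSpace Y] [MeasurableSpace Y]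
    [OpensMeasurableSpace Y] {a : Set Y} (ha : IsClopen a) (r : ENNReal) :
    IsOpen {ν : ProbabilityMeasure Y | r < (ν : Measure Y) a} := by
  classical
  have hc : Continuous (a.indicator (1 : Y → NNReal)) :=
    continuous_one.indicator (by simp [ha.frontier_eq])
  let f : BoundedContinuousFunction Y NNReal :=
    BoundedContinuousFunction.mkOfBound ⟨a.indicator 1, hc⟩ 1 (by
      intro x y
      by_cases hx : x ∈ a <;> by_cases hy : y ∈ a <;> simp [hx, hy, NNReal.dist_eq])
  have h := ProbabilityMeasure.continuous_iff_forall_continuous_lintegral.1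
    (continuous_id (X := ProbabilityMeasure Y)) f
  have h2 : (fun ν : ProbabilityMeasure Y => ∫⁻ y, f y ∂(id ν : ProbabilityMeasure Y)) =
      fun ν : ProbabilityMeasure Y => (ν : Measure Y) a := by
    ext ν
    have h3 : ∀ y, (f y : ENNReal) = a.indicator 1 y := by
      intro y
      change ((a.indicator (1 : Y → NNReal) y : NNReal) : ENNReal) = _
      by_cases hy : y ∈ a <;> simp [hy]
    simp only [h3, id]
    exact lintegral_indicator_one ha.2.measurableSet
  rw [h2] at h
  exact isOpen_lt continuous_const h

variable {G : Type u} {X : Type v} [Group G] [TopologicalSpace X] [MeasurableSpace X]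
  [BorelSpace X] [MulAction G X] [ContinuousConstSMul G X]

/-- Piecewise strong proximality and minimality: a probability measure on a clopen set can be
mostly concentrated on any non-empty clopen subset by an element of the rigid stabilizer. -/
theorem IsPiecewiseMinimalStronglyProximal.exists_half_lt [CompactSpace X] [T2Space X]
    (hX : IsPiecewiseMinimalStronglyProximal G X) {γ a : Set X} (hγ : IsClopen γ)
    (ha : IsClopen a) (hane : a.Nonempty) (haγ : a ⊆ γ) (μ : Measure X) [IsProbabilityMeasure μ]
    [μ.InnerRegular] (hμ : μ γᶜ = 0) :
    ∃ g ∈ rigidStabilizer G γ, 1 / 2 < μ (g⁻¹ • a) := by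
  obtain ⟨hmin, hsp⟩ := hX γ hγ (hane.mono haγ)
  have hemb : Topology.IsOpenEmbedding (Subtype.val : γ → X) := hγ.2.isOpenEmbedding_subtypeVal
  have hme : MeasurableEmbedding (Subtype.val : γ → X) := .subtype_coe hγ.2.measurableSet
  have hcap : ∀ s : Set X, μ (s ∩ γ) = μ s := fun s =>
    measure_inter_conull hμ
  have hcomap : ∀ s : Set X, μ.comap (Subtype.val : γ → X) (Subtype.val ⁻¹' s) = μ s := by
    intro s
    rw [hme.comap_apply, Subtype.image_preimage_coe, inter_comm, hcap]
  have hprob : IsProbabilityMeasure (μ.comap (Subtype.val : γ → X)) :=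
    ⟨by rw [← preimage_univ, hcomap]; exact measure_univ⟩
  have hreg : (μ.comap (Subtype.val : γ → X)).InnerRegular :=
    Measure.InnerRegular.comap' μ hemb
  obtain ⟨y, hy⟩ := hsp ⟨μ.comap (Subtype.val : γ → X), hprob⟩
    (inferInstanceAs (μ.comap (Subtype.val : γ → X)).Regular)
  have haγo : IsOpen (Subtype.val ⁻¹' a : Set γ) := ha.2.preimage continuous_subtype_val
  obtain ⟨_, hga, ⟨g, rfl⟩⟩ := (MulAction.dense_orbit (rigidStabilizer G γ) y).inter_open_nonempty
    _ haγo (by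
      obtain ⟨x, hx⟩ := hane
      exact ⟨⟨x, haγ hx⟩, hx⟩)
  -- Minimality gave `g • y ∈ a`, so the Dirac mass at `y` gives `g⁻¹ • a` mass one; some translate
  -- of the measure by `h` therefore gives it more than one half.
  have hb : IsClopen (Subtype.val ⁻¹' ((g : G)⁻¹ • a) : Set γ) :=
    ⟨(ha.1.smul _).preimage continuous_subtype_val, (ha.2.smul _).preimage continuous_subtype_val⟩
  obtain ⟨ν, hν, ⟨h, hh⟩⟩ := mem_closure_iff.1 hy _
    (isOpen_setOf_lt_apply_of_isClopen hb (1 / 2)) (by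
      have : y ∈ (Subtype.val ⁻¹' ((g : G)⁻¹ • a) : Set γ) := by
        rw [mem_preimage, mem_smul_set_iff_inv_smul_mem, inv_inv]
        exact hga
      rw [mem_ofPred_eq, diracProba_toMeasure_apply_of_mem this]
      exact ENNReal.half_lt_self one_ne_zero ENNReal.one_ne_top |>.trans_le le_rfl)
  refine ⟨g * h, Subgroup.mul_mem _ g.2 h.2, ?_⟩
  rw [mem_ofPred_eq, hh] at hν
  have hcont : Continuous fun z : γ => h • z :=
    Continuous.subtype_mk (continuous_subtype_val.const_smul (h : G)) _
  rw [Measure.map_apply hcont.measurable hb.2.measurableSet] at hν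
  have hset : (fun z : γ => h • z) ⁻¹' (Subtype.val ⁻¹' ((g : G)⁻¹ • a)) =
      Subtype.val ⁻¹' (((g : G) * h)⁻¹ • a) := by
    ext z
    simp only [mem_preimage, mem_smul_set_iff_inv_smul_mem, inv_inv, mul_smul]
    rfl
  rw [hset] at hν
  exact (hcomap _).symm ▸ hν

/-- A `K`-equivariant family of probability measures, one on each non-empty clopen set. -/
structure IsMeasureFamily (K : Subgroup G) (μ : Set X → Measure X) : Prop where
  isProbabilityMeasure : ∀ γ, IsClopen γ → γ.Nonempty → IsProbabilityMeasure (μ γ)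
  innerRegular : ∀ γ, IsClopen γ → γ.Nonempty → (μ γ).InnerRegular
  compl_eq_zero : ∀ γ, IsClopen γ → γ.Nonempty → μ γ γᶜ = 0
  map_smul : ∀ γ, IsClopen γ → γ.Nonempty → ∀ k ∈ K, (μ γ).map (k • ·) = μ (k • γ)

/-- The translate of a family of measures by a group element. -/
noncomputable def translateFamily (g : G) (μ : Set X → Measure X) (γ : Set X) : Measure X :=
  (μ (g⁻¹ • γ)).map (g • ·)

theorem map_smul_apply (μ : Measure X) (g : G) (s : Set X) : μ.map (g • ·) s = μ (g⁻¹ • s) := by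
  rw [← preimage_smul]
  exact (Homeomorph.smul g).toMeasurableEquiv.map_apply s

theorem map_smul_smul (μ : Measure X) (g h : G) :
    (μ.map (g • ·)).map (h • ·) = μ.map ((h * g) • ·) := by
  rw [Measure.map_map (measurable_const_smul h) (measurable_const_smul g)]
  simp only [Function.comp_def, mul_smul]

theorem translateFamily_apply (g : G) (μ : Set X → Measure X) (γ s : Set X) :
    translateFamily g μ γ s = μ (g⁻¹ • γ) (g⁻¹ • s) :=
  map_smul_apply _ _ _

theorem translateFamily_mul (g h : G) (μ : Set X → Measure X) :
    translateFamily (g * h) μ = translateFamily g (translateFamily h μ) := by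
  ext γ : 1
  simp only [translateFamily, map_smul_smul, smul_smul, mul_inv_rev]

theorem IsMeasureFamily.translate {K : Subgroup G} {μ : Set X → Measure X}
    (h : IsMeasureFamily K μ) (g : G) :
    IsMeasureFamily (K.map (MulAut.conj g).toMonoidHom) (translateFamily g μ) where
  isProbabilityMeasure γ hγ hne := by
    have := h.isProbabilityMeasure (g⁻¹ • γ) (isClopen_smul hγ _) hne.smul_set
    exact Measure.isProbabilityMeasure_map (measurable_const_smul g).aemeasurable
  innerRegular γ hγ hne := by
    have := h.innerRegular (g⁻¹ • γ) (isClopen_smul hγ _) hne.smul_set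
    exact Measure.InnerRegular.map_of_continuous (continuous_const_smul g)
  compl_eq_zero γ hγ hne := by
    rw [translateFamily_apply, smul_set_compl]
    exact h.compl_eq_zero _ (isClopen_smul hγ _) hne.smul_set
  map_smul γ hγ hne k hk := by
    obtain ⟨k, hkK, rfl⟩ := Subgroup.mem_map.1 hk
    have h1 := h.map_smul (g⁻¹ • γ) (isClopen_smul hγ _) hne.smul_set k hkK
    simp only [translateFamily, MulEquiv.coe_toMonoidHom, MulAut.conj_apply, map_smul_smul]
    rw [smul_smul, show g⁻¹ * (g * k * g⁻¹) = k * g⁻¹ by group, mul_smul, ← h1, map_smul_smul]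
    simp

theorem FixesProbability.exists_measure [CompactSpace X] [T2Space X] {K : Subgroup G} {γ : Set X}
    (hγ : IsClopen γ) (h : FixesProbability (MulAction.stabilizer K γ) γ) :
    ∃ μ : Measure X, IsProbabilityMeasure μ ∧ μ.InnerRegular ∧ μ γᶜ = 0 ∧
      ∀ k ∈ K, k • γ = γ → μ.map (k • ·) = μ := by
  obtain ⟨μ, hμ, hreg, hinv⟩ := h
  have hme : MeasurableEmbedding (Subtype.val : γ → X) := .subtype_coe hγ.2.measurableSet
  refine ⟨μ.map Subtype.val, Measure.isProbabilityMeasure_map hme.measurable.aemeasurable,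
    Measure.InnerRegular.map_of_continuous continuous_subtype_val, ?_, fun k hk hkγ => ?_⟩
  · rw [hme.map_apply]
    convert measure_empty (μ := μ)
    ext x
    simp
  · rw [Measure.map_map (measurable_const_smul k) hme.measurable]
    ext s hs
    rw [Measure.map_apply ((measurable_const_smul k).comp hme.measurable) hs,
      Measure.map_apply hme.measurable hs]
    exact hinv.measure_preimage_smul ⟨⟨k, hk⟩, hkγ⟩ (hme.measurable hs)

/-- Choose an invariant measure on one representative of each `H`-orbit of sets and transport it.
Two transports to the same set differ by an element stabilizing the representative, which gives
equivariance. -/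
theorem exists_isMeasureFamily [TopologicalSpace G] [CompactSpace X] [T2Space X]
    {H : ClosedSubgroup G} (hH : H ∈ classS G X) :
    ∃ μ : Set X → Measure X, IsMeasureFamily H.toSubgroup μ := by
  classical
  have h1 : ∀ γ : Set X, ∃ μ : Measure X, IsClopen γ → γ.Nonempty →
      IsProbabilityMeasure μ ∧ μ.InnerRegular ∧ μ γᶜ = 0 ∧
      ∀ k ∈ H.toSubgroup, k • γ = γ → μ.map (k • ·) = μ := by
    intro γ
    by_cases hγ : IsClopen γ ∧ γ.Nonempty
    · obtain ⟨μ, hμ⟩ := FixesProbability.exists_measure hγ.1 (hH γ hγ.1 hγ.2)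
      exact ⟨μ, fun _ _ => hμ⟩
    · exact ⟨0, fun h h' => absurd ⟨h, h'⟩ hγ⟩
  choose ν hν using h1
  let s := MulAction.orbitRel H.toSubgroup (Set X)
  let r : Set X → Set X := fun γ => (Quotient.mk s γ).out
  have hr : ∀ γ, ∃ h ∈ H.toSubgroup, h • r γ = γ := by
    intro γ
    obtain ⟨h, hh⟩ := Setoid.symm' s (Quotient.mk_out (s := s) γ)
    exact ⟨h, h.2, hh⟩
  have hrk : ∀ γ, ∀ k ∈ H.toSubgroup, r (k • γ) = r γ := by
    intro γ k hk
    have : (Quotient.mk s (k • γ)) = Quotient.mk s γ := Quotient.sound ⟨⟨k, hk⟩, rfl⟩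
    simp only [r, this]
  choose t htH ht using hr
  have hrt : ∀ γ, r γ = (t γ)⁻¹ • γ := fun γ => by
    rw [eq_inv_smul_iff, ht]
  have hclopen : ∀ γ, IsClopen γ → γ.Nonempty → IsClopen (r γ) ∧ (r γ).Nonempty := by
    intro γ hγ hne
    rw [hrt]
    exact ⟨isClopen_smul hγ _, hne.smul_set⟩
  refine ⟨fun γ => (ν (r γ)).map (t γ • ·), ?_, ?_, ?_, ?_⟩
  · intro γ hγ hne
    obtain ⟨h, h'⟩ := hclopen γ hγ hne
    have := (hν _ h h').1
    exact Measure.isProbabilityMeasure_map (measurable_const_smul _).aemeasurable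
  · intro γ hγ hne
    obtain ⟨h, h'⟩ := hclopen γ hγ hne
    have := (hν _ h h').2.1
    exact Measure.InnerRegular.map_of_continuous (continuous_const_smul _)
  · intro γ hγ hne
    obtain ⟨h, h'⟩ := hclopen γ hγ hne
    rw [map_smul_apply, smul_set_compl, ← hrt]
    exact (hν _ h h').2.2.1
  · intro γ hγ hne k hk
    obtain ⟨h, h'⟩ := hclopen γ hγ hne
    have h2 := (hν _ h h').2.2.2 ((t (k • γ))⁻¹ * (k * t γ))
      (Subgroup.mul_mem _ (Subgroup.inv_mem _ (htH _)) (Subgroup.mul_mem _ hk (htH _))) (by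
        rw [mul_smul, mul_smul, ht, ← hrt, hrk _ _ hk])
    simp only [map_smul_smul, hrk _ _ hk]
    conv_rhs => rw [← h2, map_smul_smul, mul_inv_cancel_left]

end Measures

/-! ### Absence of isolated points. -/

section NoIsolatedPoints

instance innerRegular_dirac {Y : Type*} [TopologicalSpace Y] [MeasurableSpace Y] (y : Y) :
    (Measure.dirac y).InnerRegular where
  innerRegular s hs r hr := by
    by_cases hy : y ∈ s
    · refine ⟨{y}, singleton_subset_iff.2 hy, isCompact_singleton, ?_⟩
      rw [Measure.dirac_apply_of_mem (mem_singleton y)]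
      rwa [Measure.dirac_apply_of_mem hy] at hr
    · rw [Measure.dirac_apply' _ hs, indicator_of_notMem hy] at hr
      exact absurd hr not_lt_zero

/-- Otherwise `{x}` is clopen and some translate of it, again a single point, has mass above one
half for `(δ_x + δ_y)/2`, which gives no point more than one half. -/
theorem IsPiecewiseMinimalStronglyProximal.not_isOpen_singleton {G : Type u} {X : Type v}
    [Group G] [TopologicalSpace X] [CompactSpace X] [T2Space X] [MeasurableSpace X] [BorelSpace X]
    [MulAction G X] [ContinuousConstSMul G X]
    (hX : IsPiecewiseMinimalStronglyProximal G X) [Nontrivial X] (x : X) :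
    ¬ IsOpen ({x} : Set X) := by
  intro hx
  obtain ⟨y, hyx⟩ := exists_ne x
  let μ : Measure X := (2⁻¹ : ENNReal) • (Measure.dirac x + Measure.dirac y)
  have hμ : IsProbabilityMeasure μ := ⟨by
    simp only [μ, Measure.smul_apply, Measure.add_apply, measure_univ, smul_eq_mul]
    rw [one_add_one_eq_two]
    exact ENNReal.inv_mul_cancel two_ne_zero ENNReal.ofNat_ne_top⟩
  obtain ⟨g, -, hg⟩ := hX.exists_half_lt isClopen_univ ⟨isClosed_singleton, hx⟩
    (singleton_nonempty x) (subset_univ _) μ (by simp)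
  rw [smul_set_singleton] at hg
  refine absurd hg (not_lt.2 ?_)
  simp only [μ, Measure.smul_apply, Measure.add_apply, smul_eq_mul, one_div]
  refine mul_le_of_le_one_right' ?_
  simp only [Measure.dirac_apply' _ (measurableSet_singleton _)]
  by_cases h : x = g⁻¹ • x
  · have : y ∉ ({g⁻¹ • x} : Set X) := fun h' => hyx (h'.trans h.symm)
    rw [indicator_of_notMem this, add_zero]
    exact indicator_le_self' (by simp) _
  · have : x ∉ ({g⁻¹ • x} : Set X) := h
    rw [indicator_of_notMem this, zero_add]
    exact indicator_le_self' (by simp) _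

end NoIsolatedPoints

/-! ### Meeting all requirements of a laminar list at once. -/

section Laminar

variable {X : Type v} [TopologicalSpace X]

/-- A list of pairs `(γ, a)` of clopen sets with `a ⊆ γ`, such that the first set of every pair is
contained in or disjoint from both sets of every earlier pair. -/
structure IsLaminar (L : List (Set X × Set X)) : Prop where
  fst_isClopen : ∀ p ∈ L, IsClopen p.1
  snd_isClopen : ∀ p ∈ L, IsClopen p.2
  nonempty : ∀ p ∈ L, p.2.Nonempty
  subset : ∀ p ∈ L, p.2 ⊆ p.1
  pairwise : L.Pairwise fun p q =>
    (q.1 ⊆ p.1 ∨ Disjoint q.1 p.1) ∧ (q.1 ⊆ p.2 ∨ Disjoint q.1 p.2)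

theorem smul_eq_of_mem_rigidStabilizer {G : Type u} {X : Type v} [Group G] [MulAction G X]
    {γ S : Set X} (h : γ ⊆ S ∨ Disjoint γ S) {g : G} (hg : g ∈ rigidStabilizer G γ) :
    g • S = S := by
  have key : ∀ g ∈ rigidStabilizer G γ, ∀ x ∈ S, g • x ∈ S := by
    intro g hg x hx
    by_cases hxγ : x ∈ γ
    · rcases h with h | h
      · exact h (rigidStabilizer_smul_mem ⟨g, hg⟩ hxγ)
      · exact absurd hx (disjoint_left.1 h hxγ)
    · rwa [(mem_fixingSubgroup_iff G).1 hg x hxγ]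
  refine Subset.antisymm ?_ fun x hx => ?_
  · rintro _ ⟨x, hx, rfl⟩
    exact key g hg x hx
  · exact mem_smul_set_iff_inv_smul_mem.2 (key _ (Subgroup.inv_mem _ hg) x hx)

variable {G : Type u} [Group G] [CompactSpace X] [T2Space X] [MeasurableSpace X] [BorelSpace X]
    [MulAction G X] [ContinuousConstSMul G X]

/-- The head pair is treated first. The clause about `S` strengthens the induction: it makes the
element treating the tail preserve both sets of the head pair, so the mass already gained there
survives. -/
theorem IsPiecewiseMinimalStronglyProximal.exists_translateFamily
    (hX : IsPiecewiseMinimalStronglyProximal G X) {L : List (Set X × Set X)} (hL : IsLaminar L)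
    {K : Subgroup G} {μ : Set X → Measure X} (hμ : IsMeasureFamily K μ) :
    ∃ g : G, (∀ S : Set X, (∀ p ∈ L, p.1 ⊆ S ∨ Disjoint p.1 S) → g • S = S) ∧
      ∀ p ∈ L, 1 / 2 < translateFamily g μ p.1 p.2 := by
  induction L generalizing K μ with
  | nil => exact ⟨1, by simp, by simp⟩
  | cons p L ih =>
    obtain ⟨h1, h2, h3, h4, h5⟩ := hL
    rw [List.pairwise_cons] at h5
    rw [List.forall_mem_cons] at h1 h2 h3 h4
    have hne : p.1.Nonempty := h3.1.mono h4.1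
    have := hμ.isProbabilityMeasure p.1 h1.1 hne
    have := hμ.innerRegular p.1 h1.1 hne
    obtain ⟨g, hg, hgp⟩ := hX.exists_half_lt h1.1 h2.1 h3.1 h4.1 (μ p.1)
      (hμ.compl_eq_zero p.1 h1.1 hne)
    obtain ⟨h, hhS, hhL⟩ := ih ⟨h1.2, h2.2, h3.2, h4.2, h5.2⟩ (hμ.translate g)
    refine ⟨h * g, fun S hS => ?_, ?_⟩
    · rw [List.forall_mem_cons] at hS
      rw [mul_smul, smul_eq_of_mem_rigidStabilizer hS.1 hg, hhS S hS.2]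
    · rw [translateFamily_mul, List.forall_mem_cons]
      refine ⟨?_, hhL⟩
      have e1 : h⁻¹ • p.1 = p.1 := by
        rw [inv_smul_eq_iff, hhS _ fun q hq => (h5.1 q hq).1]
      have e2 : h⁻¹ • p.2 = p.2 := by
        rw [inv_smul_eq_iff, hhS _ fun q hq => (h5.1 q hq).2]
      have e3 : g⁻¹ • p.1 = p.1 := by
        rw [inv_smul_eq_iff, smul_eq_of_mem_rigidStabilizer (Or.inl Subset.rfl) hg]
      rwa [translateFamily_apply, e1, e2, translateFamily_apply, e3]

theorem not_disjoint_of_half_lt {Y : Type*} [MeasurableSpace Y] {μ : Measure Y}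
    [IsProbabilityMeasure μ] {s t : Set Y} (ht : MeasurableSet t) (hs : 1 / 2 < μ s)
    (ht' : 1 / 2 < μ t) : ¬ Disjoint s t := by
  intro h
  have h1 : μ s + μ t ≤ 1 := by
    rw [← measure_union h ht]
    exact prob_le_one
  have h2 := ENNReal.add_lt_add hs ht'
  rw [ENNReal.add_halves] at h2
  exact absurd h1 (not_le.2 h2)

end Laminar

/-! ### Requirements that exclude the displacing elements of one coset. -/

section Step

theorem IsMeasureFamily.not_disjoint_smul {G : Type u} {X : Type v} [Group G]
    [TopologicalSpace X] [MeasurableSpace X] [BorelSpace X] [MulAction G X]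
    [ContinuousConstSMul G X] {K : Subgroup G} {μ : Set X → Measure X}
    (hμ : IsMeasureFamily K μ) {γ a b : Set X} {k : G} (hk : k ∈ K) (hγ : IsClopen γ)
    (hne : γ.Nonempty) (hb : IsClopen b) (h1 : 1 / 2 < μ γ a) (h2 : 1 / 2 < μ (k • γ) b) :
    ¬ Disjoint (k • a) b := by
  have := hμ.isProbabilityMeasure _ (isClopen_smul hγ k) hne.smul_set
  refine not_disjoint_of_half_lt (μ := μ (k • γ)) hb.2.measurableSet ?_ h2
  rwa [← hμ.map_smul γ hγ hne k hk, map_smul_apply, inv_smul_smul]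

theorem exists_isClopen_separating {X : Type*} [TopologicalSpace X] [TotallySeparatedSpace X]
    {x y : X} (h : x ≠ y) :
    ∃ S : Set X, IsClopen S ∧ x ∈ S ∧ y ∉ S := by
  obtain ⟨S, hS, hx, hy⟩ := exists_isClopen_of_totally_separated h
  exact ⟨S, hS, hx, hy⟩

theorem exists_mem_ne_of_isOpen {X : Type*} [TopologicalSpace X]
    (hiso : ∀ x : X, ¬ IsOpen ({x} : Set X)) {s : Set X}
    (hs : IsOpen s) {x : X} (hx : x ∈ s) : ∃ y ∈ s, y ≠ x := by
  by_contra! h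
  refine hiso x ?_
  rwa [show ({x} : Set X) = s from Subset.antisymm (singleton_subset_iff.2 hx) h]

variable {G : Type u} {X : Type v} [Group G] [TopologicalSpace G] [TopologicalSpace X]
  [CompactSpace X] [T2Space X] [TotallyDisconnectedSpace X] [MeasurableSpace X] [BorelSpace X]
  [MulAction G X] [ContinuousSMul G X]

/-- A laminar list can be extended so that no group for which the masses are concentrated along
the extension contains an element of `c U` displacing `α`. -/
theorem IsLaminar.exists_append (hiso : ∀ x : X, ¬ IsOpen ({x} : Set X)) {U : Subgroup G}
    (hU : IsCompact (U : Set G)) {L : List (Set X × Set X)} (hL : IsLaminar L) (c : G)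
    {α : Set X} (hα : IsClopen α) (hne : α.Nonempty) :
    ∃ L' : List (Set X × Set X), IsLaminar (L ++ L') ∧
      ∀ (K : Subgroup G) (μ : Set X → Measure X), IsMeasureFamily K μ →
        (∀ p ∈ L', 1 / 2 < μ p.1 p.2) →
        ∀ k ∈ K, c⁻¹ * k ∈ U → ¬ Disjoint (k • α) α := by
  classical
  -- The `c⁻¹`-translates ensure that `k • A`, for `k ∈ cU`, is nested in or disjoint from every
  -- earlier set.
  let 𝓢₀ : Set (Set X) := insert α
    (⋃ p ∈ {p | p ∈ L}, {p.1, p.2, c⁻¹ • p.1, c⁻¹ • p.2})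
  have hfin₀ : 𝓢₀.Finite :=
    ((List.finite_toSet L).biUnion fun p _ => by simp).insert α
  have hcl₀ : ∀ S ∈ 𝓢₀, IsClopen S := by
    rintro S (rfl | hS)
    · exact hα
    · obtain ⟨p, hp, hS⟩ := mem_iUnion₂.1 hS
      rcases hS with rfl | rfl | rfl | rfl
      · exact hL.fst_isClopen p hp
      · exact hL.snd_isClopen p hp
      · exact isClopen_smul (hL.fst_isClopen p hp) _
      · exact isClopen_smul (hL.snd_isClopen p hp) _
  have hmemL : ∀ p ∈ L, p.1 ∈ 𝓢₀ ∧ p.2 ∈ 𝓢₀ ∧ c⁻¹ • p.1 ∈ 𝓢₀ ∧ c⁻¹ • p.2 ∈ 𝓢₀ := by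
    intro p hp
    refine ⟨?_, ?_, ?_, ?_⟩ <;>
    exact Or.inr (mem_iUnion₂.2 ⟨p, hp, by simp⟩)
  obtain ⟨x, hx⟩ := hne
  -- Three points of one `𝓢₀`-cell: `z` leaves the cell of `x` at level `𝓢₁`, whereas `y` leaves it
  -- only at level `𝓢₂`.
  obtain ⟨z, hz, hzx⟩ := exists_mem_ne_of_isOpen hiso (isOpen_agreeClass hU hfin₀ hcl₀ x)
    (mem_agreeClass_self U 𝓢₀ x)
  obtain ⟨S₁, hS₁, hxS₁, hzS₁⟩ := exists_isClopen_separating hzx.symm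
  let 𝓢₁ := insert S₁ 𝓢₀
  have hfin₁ : 𝓢₁.Finite := hfin₀.insert _
  have hcl₁ : ∀ S ∈ 𝓢₁, IsClopen S := forall_mem_insert.2 ⟨hS₁, hcl₀⟩
  have h01 : 𝓢₀ ⊆ 𝓢₁ := subset_insert _ _
  obtain ⟨y, hy, hyx⟩ := exists_mem_ne_of_isOpen hiso (isOpen_agreeClass hU hfin₁ hcl₁ x)
    (mem_agreeClass_self U 𝓢₁ x)
  obtain ⟨S₂, hS₂, hxS₂, hyS₂⟩ := exists_isClopen_separating hyx.symm
  let 𝓢₂ := insert S₂ 𝓢₁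
  have hfin₂ : 𝓢₂.Finite := hfin₁.insert _
  have hcl₂ : ∀ S ∈ 𝓢₂, IsClopen S := forall_mem_insert.2 ⟨hS₂, hcl₁⟩
  have h12 : 𝓢₁ ⊆ 𝓢₂ := subset_insert _ _
  have hxz : ¬ Agree U 𝓢₁ x z := fun h => hzS₁ ((h.mem_iff (mem_insert _ _)).1 hxS₁)
  have hxy : ¬ Agree U 𝓢₂ x y := fun h => hyS₂ ((h.mem_iff (mem_insert _ _)).1 hxS₂)
  set A := agreeClass U 𝓢₀ x with hA
  have hAα : A ⊆ α := fun w hw => (Agree.mem_iff hw (mem_insert α _)).1 hx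
  have hAcl : IsClopen A := isClopen_agreeClass hU hfin₀ hcl₀ x
  have hcl : ∀ w, IsClopen (agreeClass U 𝓢₂ w) := isClopen_agreeClass hU hfin₂ hcl₂
  have hsub : ∀ w, Agree U 𝓢₀ x w → agreeClass U 𝓢₂ w ⊆ A := fun w hw t ht =>
    hw.trans (Agree.mono ht (h01.trans h12))
  have hxA := hsub x (Agree.refl U 𝓢₀ x)
  have hyA := hsub y (Agree.mono hy h01)
  have hzA := hsub z hz
  have hdisj : ∀ w, ¬ Agree U 𝓢₂ x w →
      Disjoint (agreeClass U 𝓢₂ w) (agreeClass U 𝓢₂ x) := fun w hw =>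
    disjoint_left.2 fun t ht ht' => hw (Agree.trans ht' (Agree.symm ht))
  have hdy := hdisj y hxy
  have hdz := hdisj z fun h => hxz (h.mono h12)
  let B : Set (Set X) := {β | ∃ k : G, c⁻¹ * k ∈ U ∧ Disjoint (k • α) α ∧ β = k • A}
  have hBfin : B.Finite := by
    refine ((finite_range_agreeClass hU hfin₀ hcl₀).image (c • ·)).subset ?_
    rintro _ ⟨k, hk, -, rfl⟩
    exact ⟨_, ⟨_, rfl⟩, (smul_agreeClass_of_coset hk).symm⟩
  have hκ : ∀ β : Set X, ∃ k : G, β ∈ B → c⁻¹ * k ∈ U ∧ Disjoint (k • α) α ∧ β = k • A := by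
    intro β
    by_cases hβ : β ∈ B
    · obtain ⟨k, hk⟩ := hβ
      exact ⟨k, fun _ => hk⟩
    · exact ⟨1, fun h => absurd h hβ⟩
  choose κ hκ using hκ
  -- The heavy cells are at `x`, `y` inside `A`, but at the `κ β`-images of `x`, `z` inside `β`.
  -- Removing the first heavy cell provides a second clopen set to weigh.
  let f : Set X → List (Set X × Set X) := fun β =>
    [(β, κ β • agreeClass U 𝓢₂ x), (β \ κ β • agreeClass U 𝓢₂ x, κ β • agreeClass U 𝓢₂ z)]
  let L₁ : List (Set X × Set X) :=
    [(A, agreeClass U 𝓢₂ x), (A \ agreeClass U 𝓢₂ x, agreeClass U 𝓢₂ y)]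
  let L₂ : List (Set X × Set X) := hBfin.toFinset.toList.flatMap f
  have hmem₁ : ∀ p ∈ L₁, p.1 ⊆ A ∧ p.2 ⊆ p.1 ∧ IsClopen p.1 ∧ IsClopen p.2 ∧ p.2.Nonempty := by
    simp only [L₁, List.forall_mem_cons, List.not_mem_nil, false_implies, implies_true, and_true]
    exact ⟨⟨Subset.rfl, hxA, hAcl, hcl x, ⟨x, mem_agreeClass_self _ _ _⟩⟩,
      sdiff_subset, subset_sdiff.2 ⟨hyA, hdy⟩, hAcl.diff (hcl x), hcl y,
      ⟨y, mem_agreeClass_self _ _ _⟩⟩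
  have hmemf : ∀ β ∈ B, ∀ p ∈ f β,
      p.1 ⊆ β ∧ p.2 ⊆ p.1 ∧ IsClopen p.1 ∧ IsClopen p.2 ∧ p.2.Nonempty := by
    intro β hβ
    obtain ⟨-, -, hβA⟩ := hκ β hβ
    have hβcl : IsClopen β := hβA ▸ isClopen_smul hAcl _
    have hsx : κ β • agreeClass U 𝓢₂ x ⊆ β := by
      conv_rhs => rw [hβA]
      exact smul_set_mono hxA
    have hsz : κ β • agreeClass U 𝓢₂ z ⊆ β := by
      conv_rhs => rw [hβA]
      exact smul_set_mono hzA
    simp only [f, List.forall_mem_cons, List.not_mem_nil, false_implies, implies_true, and_true]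
    exact ⟨⟨Subset.rfl, hsx, hβcl, isClopen_smul (hcl x) _,
        Nonempty.smul_set ⟨x, mem_agreeClass_self _ _ _⟩⟩,
      sdiff_subset, subset_sdiff.2 ⟨hsz, Set.disjoint_smul_set.2 hdz⟩,
      hβcl.diff (isClopen_smul (hcl x) _), isClopen_smul (hcl z) _,
      Nonempty.smul_set ⟨z, mem_agreeClass_self _ _ _⟩⟩
  have hmem₂ : ∀ p ∈ L₂, ∃ β ∈ B, p ∈ f β := by
    intro p hp
    obtain ⟨β, hβ, hp⟩ := List.mem_flatMap.1 hp
    exact ⟨β, by simpa using hβ, hp⟩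
  have hBA : ∀ β ∈ B, Disjoint β A := by
    rintro _ ⟨k, -, hk, rfl⟩
    exact hk.mono (smul_set_mono hAα) hAα
  have hBB : ∀ β ∈ B, ∀ β' ∈ B, β ≠ β' → Disjoint β β' := by
    rintro _ ⟨k, hk, -, rfl⟩ _ ⟨k', hk', -, rfl⟩ hne
    by_contra h
    exact hne (smul_agreeClass_eq_of_not_disjoint hk hk' h)
  have hnest : ∀ γ a : Set X,
      (γ \ a ⊆ γ ∨ Disjoint (γ \ a) γ) ∧ (γ \ a ⊆ a ∨ Disjoint (γ \ a) a) := fun γ a =>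
    ⟨Or.inl sdiff_subset, Or.inr disjoint_sdiff_left⟩
  have hfar : ∀ p q : Set X × Set X, ∀ S T : Set X, p.1 ⊆ S → p.2 ⊆ p.1 → q.1 ⊆ T →
      Disjoint T S → (q.1 ⊆ p.1 ∨ Disjoint q.1 p.1) ∧ (q.1 ⊆ p.2 ∨ Disjoint q.1 p.2) :=
    fun p q S T h1 h2 h3 h4 => ⟨Or.inr (h4.mono h3 h1), Or.inr (h4.mono h3 (h2.trans h1))⟩
  have hall : ∀ p ∈ L₁ ++ L₂, p.2 ⊆ p.1 ∧ IsClopen p.1 ∧ IsClopen p.2 ∧ p.2.Nonempty := by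
    intro p hp
    rcases List.mem_append.1 hp with hp | hp
    · exact (hmem₁ p hp).2
    · obtain ⟨β, hβ, hp⟩ := hmem₂ p hp
      exact (hmemf β hβ p hp).2
  refine ⟨L₁ ++ L₂, ⟨?_, ?_, ?_, ?_, ?_⟩, ?_⟩
  · exact List.forall_mem_append.2 ⟨hL.fst_isClopen, fun p hp => (hall p hp).2.1⟩
  · exact List.forall_mem_append.2 ⟨hL.snd_isClopen, fun p hp => (hall p hp).2.2.1⟩
  · exact List.forall_mem_append.2 ⟨hL.nonempty, fun p hp => (hall p hp).2.2.2⟩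
  · exact List.forall_mem_append.2 ⟨hL.subset, fun p hp => (hall p hp).1⟩
  · refine List.pairwise_append.2 ⟨hL.pairwise, List.pairwise_append.2 ⟨?_, ?_, ?_⟩, ?_⟩
    · simpa [L₁] using hnest A (agreeClass U 𝓢₂ x)
    · refine List.pairwise_flatMap.2 ⟨fun β _ => ?_, ?_⟩
      · simpa [f] using hnest β (κ β • agreeClass U 𝓢₂ x)
      · refine (Finset.nodup_toList _).pairwise_of_forall_ne fun β hβ β' hβ' hne p hp q hq => ?_
        have hβ : β ∈ B := by simpa using hβ
        have hβ' : β' ∈ B := by simpa using hβ'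
        exact hfar p q β β' (hmemf β hβ p hp).1 (hmemf β hβ p hp).2.1 (hmemf β' hβ' q hq).1
          (hBB β' hβ' β hβ hne.symm)
    · intro p hp q hq
      obtain ⟨β, hβ, hq⟩ := hmem₂ q hq
      exact hfar p q A β (hmem₁ p hp).1 (hmem₁ p hp).2.1 (hmemf β hβ q hq).1 (hBA β hβ)
    · intro p hp q hq
      obtain ⟨m1, m2, m3, m4⟩ := hmemL p hp
      rcases List.mem_append.1 hq with hq | hq
      · have hqA := (hmem₁ q hq).1
        exact ⟨(agreeClass_subset_or_disjoint m1).imp hqA.trans fun h => h.mono_left hqA,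
          (agreeClass_subset_or_disjoint m2).imp hqA.trans fun h => h.mono_left hqA⟩
      · obtain ⟨β, hβ, hq⟩ := hmem₂ q hq
        have hqβ := (hmemf β hβ q hq).1
        obtain ⟨k, hk, -, rfl⟩ := hβ
        exact ⟨(smul_agreeClass_subset_or_disjoint hk m3).imp hqβ.trans fun h => h.mono_left hqβ,
          (smul_agreeClass_subset_or_disjoint hk m4).imp hqβ.trans fun h => h.mono_left hqβ⟩
  · intro K μ hμ hmass k hk hkU hkα
    have hβ : k • A ∈ B := ⟨k, hkU, hkα, rfl⟩
    obtain ⟨hκU, -, hκA⟩ := hκ _ hβ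
    have hin : ∀ p ∈ f (k • A), 1 / 2 < μ p.1 p.2 := fun p hp =>
      hmass p (List.mem_append_right _ (List.mem_flatMap.2 ⟨k • A, by simpa using hβ, hp⟩))
    simp only [L₁, f, List.forall_mem_append, List.forall_mem_cons, List.not_mem_nil,
      false_implies, implies_true, and_true] at hmass hin
    obtain ⟨⟨hm1, hm2⟩, -⟩ := hmass
    obtain ⟨hm3, hm4⟩ := hin
    -- The `k`- and `κ`-images of the cell of `x` are both heavy in `k • A`, so they meet and
    -- coincide. Their complements in `k • A` then coincide too, and the second requirements
    -- identify the `k`-image of the cell of `y` with the `κ`-image of that of `z`.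
    have e1 := smul_agreeClass_eq_of_not_disjoint hkU hκU
      (hμ.not_disjoint_smul hk hAcl ⟨x, mem_agreeClass_self _ _ _⟩ (isClopen_smul (hcl x) _) hm1 hm3)
    rw [← e1, ← smul_set_sdiff] at hm4
    have e2 := smul_agreeClass_eq_of_not_disjoint hkU hκU
      (hμ.not_disjoint_smul hk (hAcl.diff (hcl x))
        ⟨y, hyA (mem_agreeClass_self _ _ _), fun h => hxy h⟩ (isClopen_smul (hcl z) _) hm2 hm4)
    set w := (κ (k • A))⁻¹ * k with hw
    have hwU : w ∈ U := by
      have := U.mul_mem (U.inv_mem hκU) hkU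
      rwa [mul_inv_rev, inv_inv, mul_assoc, mul_inv_cancel_left] at this
    have e3 : ∀ s t : X, k • agreeClass U 𝓢₂ s = κ (k • A) • agreeClass U 𝓢₂ t →
        Agree U 𝓢₁ (w • s) t := by
      intro s t h
      rw [← inv_smul_eq_iff, smul_smul, ← hw, smul_agreeClass hwU] at h
      have ht : t ∈ agreeClass U 𝓢₂ (w • s) := h ▸ mem_agreeClass_self _ _ _
      exact Agree.mono ht h12
    -- At level `𝓢₁`, `x` agrees with `w • x`, then with `w • y` since `w ∈ U`, then with `z`: a
    -- contradiction.
    exact hxz (((e3 x x e1).symm.trans (Agree.smul hy hwU)).trans (e3 y z e2))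

end Step

/-! ### Conjugating off a compact set, and the Chabauty topology. -/

section Confined

theorem exists_isClopen_disjoint_smul {G : Type u} {X : Type v} [Group G] [TopologicalSpace X]
    [TotallySeparatedSpace X] [MulAction G X] [ContinuousConstSMul G X] [FaithfulSMul G X]
    {c : G} (hc : c ≠ 1) :
    ∃ α : Set X, IsClopen α ∧ α.Nonempty ∧ Disjoint (c • α) α := by
  obtain ⟨x, hx⟩ : ∃ x : X, c • x ≠ x := by
    by_contra! h
    exact hc (eq_of_smul_eq_smul (α := X) fun x => by rw [h, one_smul])
  obtain ⟨S, hS, hxS, hcS⟩ := exists_isClopen_separating hx.symm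
  refine ⟨S \ c⁻¹ • S, hS.diff (isClopen_smul hS _), ⟨x, hxS, ?_⟩, ?_⟩
  · rwa [mem_smul_set_iff_inv_smul_mem, inv_inv]
  · rw [smul_set_sdiff, smul_inv_smul]
    exact disjoint_sdiff_left.mono_right sdiff_subset

theorem isOpen_setOf_disjoint_smul {G : Type u} {X : Type v} [Group G] [TopologicalSpace G]
    [TopologicalSpace X] [CompactSpace X] [MulAction G X] [ContinuousSMul G X]
    {α : Set X} (hα : IsClopen α) :
    IsOpen {k : G | Disjoint (k • α) α} := by
  convert isOpen_setOf_forall_smul_mem (G := G) hα.1.isCompact hα.compl.2 using 3 with k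
  rw [disjoint_left]
  exact forall_mem_image

/-- Conditions of meeting an open `V` cost nothing: `V` must contain `1`, which lies in every
subgroup. Only avoidance of compact sets remains. -/
theorem exists_isCompact_of_isOpen_chabauty {G : Type u} [Group G] [TopologicalSpace G]
    {O : Set (ClosedSubgroup G)} (hO : IsOpen O)
    {E : ClosedSubgroup G} (hE : (E : Set G) = {1}) (hEO : E ∈ O) :
    ∃ C : Set G, IsCompact C ∧ (1 : G) ∉ C ∧
      ∀ K : ClosedSubgroup G, Disjoint (K : Set G) C → K ∈ O := by
  induction hO with
  | basic s hs =>
    rcases hs with ⟨C, hC, rfl⟩ | ⟨V, hV, rfl⟩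
    · refine ⟨C, hC, fun h => ?_, fun K hK => hK.inter_eq⟩
      have hEO : (E : Set G) ∩ C = ∅ := hEO
      rw [hE] at hEO
      exact (hEO ▸ ⟨rfl, h⟩ : (1 : G) ∈ (∅ : Set G))
    · refine ⟨∅, isCompact_empty, notMem_empty _, fun K _ => ?_⟩
      obtain ⟨x, hx, hxV⟩ : ((E : Set G) ∩ V).Nonempty := hEO
      rw [hE, mem_singleton_iff] at hx
      exact ⟨1, one_mem K, hx ▸ hxV⟩
  | univ => exact ⟨∅, isCompact_empty, notMem_empty _, fun K _ => mem_univ K⟩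
  | inter s t _ _ hs ht =>
    obtain ⟨C, hC, h1, hC'⟩ := hs hEO.1
    obtain ⟨D, hD, h2, hD'⟩ := ht hEO.2
    refine ⟨C ∪ D, hC.union hD, fun h => h.elim h1 h2, fun K hK => ?_⟩
    rw [disjoint_union_right] at hK
    exact ⟨hC' K hK.1, hD' K hK.2⟩
  | sUnion S _ ih =>
    obtain ⟨s, hs, hEs⟩ := hEO
    obtain ⟨C, hC, h1, hC'⟩ := ih s hs hEs
    exact ⟨C, hC, h1, fun K hK => ⟨s, hs, hC' K hK⟩⟩

variable {G : Type u} {X : Type v} [Group G] [TopologicalSpace G]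
  [TopologicalSpace X] [CompactSpace X] [T2Space X] [TotallyDisconnectedSpace X]
  [MeasurableSpace X] [BorelSpace X] [MulAction G X] [ContinuousSMul G X]

theorem exists_isLaminar_of_list (hiso : ∀ x : X, ¬ IsOpen ({x} : Set X)) {U : Subgroup G}
    (hU : IsCompact (U : Set G)) (T : List (G × Set X))
    (hT : ∀ t ∈ T, IsClopen t.2 ∧ t.2.Nonempty) :
    ∃ L : List (Set X × Set X), IsLaminar L ∧
      ∀ (K : Subgroup G) (μ : Set X → Measure X), IsMeasureFamily K μ →
        (∀ p ∈ L, 1 / 2 < μ p.1 p.2) →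
        ∀ k ∈ K, ∀ t ∈ T, t.1⁻¹ * k ∈ U → ¬ Disjoint (k • t.2) t.2 := by
  induction T with
  | nil => exact ⟨[], ⟨by simp, by simp, by simp, by simp, List.Pairwise.nil⟩, by simp⟩
  | cons t T ih =>
    rw [List.forall_mem_cons] at hT
    obtain ⟨L, hL, h⟩ := ih hT.2
    obtain ⟨L', hL', h'⟩ := hL.exists_append hiso hU t.1 hT.1.1 hT.1.2
    refine ⟨L ++ L', hL', fun K μ hμ hm k hk => ?_⟩
    rw [List.forall_mem_append] at hm
    rw [List.forall_mem_cons]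
    exact ⟨h' K μ hμ hm.2 k hk, h K μ hμ hm.1 k hk⟩

theorem exists_conj_disjoint [IsTopologicalGroup G] [LocallyCompactSpace G]
    [TotallyDisconnectedSpace G] [FaithfulSMul G X] (hX : IsPiecewiseMinimalStronglyProximal G X)
    {H : ClosedSubgroup G}
    (hH : H ∈ classS G X) {C : Set G} (hC : IsCompact C) (h1 : (1 : G) ∉ C) :
    ∃ g : G, Disjoint (H.toSubgroup.map (MulAut.conj g).toMonoidHom : Set G) C := by
  -- If `X` has at most one point, faithfulness makes `G` trivial and `C` empty.
  rcases subsingleton_or_nontrivial X with hs | hn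
  · refine ⟨1, disjoint_right.2 fun c hc => ?_⟩
    have : c = 1 := eq_of_smul_eq_smul (α := X) fun x => Subsingleton.elim _ _
    exact absurd (this ▸ hc) h1
  obtain ⟨U, hUo, hUc⟩ := exists_isCompact_isOpen_subgroup G
  have hα : ∀ c : G, ∃ α : Set X, c ≠ 1 → IsClopen α ∧ α.Nonempty ∧ Disjoint (c • α) α := by
    intro c
    by_cases hc : c = 1
    · exact ⟨∅, fun h => absurd hc h⟩
    · obtain ⟨α, h⟩ := exists_isClopen_disjoint_smul (X := X) hc
      exact ⟨α, fun _ => h⟩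
  choose α hα using hα
  have hne : ∀ c ∈ C, c ≠ 1 := fun c hc h => h1 (h ▸ hc)
  obtain ⟨t, htC, ht⟩ := hC.elim_nhds_subcover
    (fun c => {k | c⁻¹ * k ∈ U} ∩ {k | Disjoint (k • α c) (α c)}) fun c hc => by
      refine Filter.inter_mem ?_ ?_
      · exact (hUo.preimage (continuous_const_mul c⁻¹)).mem_nhds (by simp [U.one_mem])
      · exact (isOpen_setOf_disjoint_smul (hα c (hne c hc)).1).mem_nhds (hα c (hne c hc)).2.2
  obtain ⟨L, hL, hLk⟩ := exists_isLaminar_of_list (fun x => hX.not_isOpen_singleton x) hUc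
    (t.toList.map fun c => (c, α c)) (by
      intro p hp
      obtain ⟨c, hc, rfl⟩ := List.mem_map.1 hp
      have h := hα c (hne c (htC c (Finset.mem_toList.1 hc)))
      exact ⟨h.1, h.2.1⟩)
  obtain ⟨μ, hμ⟩ := exists_isMeasureFamily hH
  obtain ⟨g, -, hg⟩ := hX.exists_translateFamily hL hμ
  refine ⟨g, disjoint_left.2 fun k hk hkC => ?_⟩
  obtain ⟨c, hc, hkU, hkα⟩ := mem_iUnion₂.1 (ht hkC)
  exact hLk _ _ (hμ.translate g) hg k hk (c, α c)
    (List.mem_map.2 ⟨c, Finset.mem_toList.2 hc, rfl⟩) hkU hkα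

theorem not_isConfined_of_mem_classS [IsTopologicalGroup G] [LocallyCompactSpace G]
    [TotallyDisconnectedSpace G] [FaithfulSMul G X] (hX : IsPiecewiseMinimalStronglyProximal G X)
    {H : ClosedSubgroup G}
    (hH : H ∈ classS G X) : ¬ IsConfined H := by
  intro hconf
  let E : ClosedSubgroup G := ⟨⊥, by
    change IsClosed ((⊥ : Subgroup G) : Set G)
    rw [Subgroup.coe_bot]
    exact isClosed_singleton⟩
  have hE : (E : Set G) = {1} := Subgroup.coe_bot
  refine hconf E (mem_closure_iff.2 fun O hO hEO => ?_) hE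
  obtain ⟨C, hC, h1, hCO⟩ := exists_isCompact_of_isOpen_chabauty hO hE hEO
  obtain ⟨g, hg⟩ := exists_conj_disjoint hX hH hC h1
  have himage : (H.toSubgroup.map (MulAut.conj g).toMonoidHom : Set G) =
      (fun h : G => g * h * g⁻¹) '' (H : Set G) := rfl
  have hclosed : IsClosed (H.toSubgroup.map (MulAut.conj g).toMonoidHom : Set G) := by
    rw [himage]
    exact ((Homeomorph.mulLeft g).trans (Homeomorph.mulRight g⁻¹)).isClosedMap _ H.isClosed'
  exact ⟨⟨H.toSubgroup.map (MulAut.conj g).toMonoidHom, hclosed⟩, hCO _ hg, g, himage⟩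

end Confined

/-! ### A compact `G`-space detecting all clopen sets, for relative amenability. -/

section ChoiceSpace

variable (G : Type u) (X : Type v) [Group G] [TopologicalSpace X] [MulAction G X]

/-- The space of functions choosing a point in every non-empty clopen set. -/
def ChoiceSpace (X : Type v) [TopologicalSpace X] : Type v :=
  {f : {γ : Set X // IsClopen γ ∧ γ.Nonempty} → X // ∀ γ, f γ ∈ γ.1}

instance : TopologicalSpace (ChoiceSpace X) := instTopologicalSpaceSubtype

instance : MeasurableSpace (ChoiceSpace X) := borel _

instance : BorelSpace (ChoiceSpace X) := ⟨rfl⟩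

instance [T2Space X] : T2Space (ChoiceSpace X) := inferInstanceAs (T2Space (Subtype _))

instance : Nonempty (ChoiceSpace X) := ⟨⟨fun γ => γ.2.2.some, fun γ => γ.2.2.some_mem⟩⟩

instance [CompactSpace X] : CompactSpace (ChoiceSpace X) := by
  refine isCompact_iff_compactSpace.1 (IsClosed.isCompact ?_)
  have h : {f : {γ : Set X // IsClopen γ ∧ γ.Nonempty} → X | ∀ γ, f γ ∈ γ.1} =
      ⋂ γ, (fun f => f γ) ⁻¹' γ.1 := by
    ext f
    simp
  change IsClosed {f : {γ : Set X // IsClopen γ ∧ γ.Nonempty} → X | ∀ γ, f γ ∈ γ.1}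
  rw [h]
  exact isClosed_iInter fun γ => γ.2.1.1.preimage (continuous_apply γ)

/-- The action of `G` on non-empty clopen sets. -/
instance [ContinuousConstSMul G X] : MulAction G {γ : Set X // IsClopen γ ∧ γ.Nonempty} where
  smul g γ := ⟨g • γ.1, isClopen_smul γ.2.1 g, γ.2.2.smul_set⟩
  one_smul γ := Subtype.ext (one_smul G γ.1)
  mul_smul g h γ := Subtype.ext (mul_smul g h γ.1)

/-- The action of `G` on choice functions by conjugation. -/
instance [ContinuousConstSMul G X] : MulAction G (ChoiceSpace X) where
  smul g f := ⟨fun γ => g • f.1 (g⁻¹ • γ), fun γ => by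
    have h : f.1 (g⁻¹ • γ) ∈ g⁻¹ • γ.1 := f.2 (g⁻¹ • γ)
    rwa [mem_smul_set_iff_inv_smul_mem, inv_inv] at h⟩
  one_smul f := Subtype.ext <| funext fun γ => by
    change (1 : G) • f.1 ((1 : G)⁻¹ • γ) = f.1 γ
    simp
  mul_smul g h f := Subtype.ext <| funext fun γ => by
    change (g * h) • f.1 ((g * h)⁻¹ • γ) = g • h • f.1 (h⁻¹ • g⁻¹ • γ)
    simp [mul_smul]

instance [TopologicalSpace G] [IsTopologicalGroup G] [CompactSpace X] [ContinuousSMul G X] :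
    ContinuousSMul G (ChoiceSpace X) where
  continuous_smul := by
    refine Continuous.subtype_mk (continuous_pi fun γ => ?_) _
    rw [continuous_iff_continuousAt]
    rintro ⟨g₀, f₀⟩
    -- Stabilizers of clopen sets are open, so the coordinate `g⁻¹ • γ` being read is constant for
    -- `g` near `g₀`.
    have hopen : IsOpen {g : G | g₀⁻¹ * g ∈ MulAction.stabilizer G (g₀⁻¹ • γ.1)} :=
      (isOpen_stabilizer_of_isCompact_of_isOpen (isClopen_smul γ.2.1 _).1.isCompact
        (isClopen_smul γ.2.1 _).2).preimage (continuous_const_mul _)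
    have hcont : Continuous fun p : G × ChoiceSpace X => p.1 • p.2.1 (g₀⁻¹ • γ) :=
      continuous_fst.smul ((continuous_apply _).comp (continuous_subtype_val.comp continuous_snd))
    refine hcont.continuousAt.congr ?_
    filter_upwards [continuous_fst.continuousAt.eventually
      (hopen.mem_nhds (x := g₀) (by simp))] with p hp
    have h : g₀⁻¹ • γ = p.1⁻¹ • γ := by
      refine Subtype.ext ?_
      change g₀⁻¹ • γ.1 = p.1⁻¹ • γ.1
      have h : (g₀⁻¹ * p.1) • g₀⁻¹ • γ.1 = g₀⁻¹ • γ.1 := hp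
      rw [mul_smul] at h
      exact eq_inv_smul_iff.2 (MulAction.injective _ h)
    rw [h]

end ChoiceSpace

/-- Evaluation at `α` commutes with the elements stabilizing `α`, so it pushes an `H`-invariant
measure on `ChoiceSpace X` to the required one. -/
theorem IsRelativelyAmenable.mem_classS {G : Type u} {X : Type v} [Group G] [TopologicalSpace G]
    [IsTopologicalGroup G] [TopologicalSpace X] [CompactSpace X] [T2Space X]
    [MeasurableSpace X] [BorelSpace X] [MulAction G X] [ContinuousSMul G X]
    {H : ClosedSubgroup G} (hH : IsRelativelyAmenable.{u, v} H) : H ∈ classS G X := by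
  intro α hα hne
  obtain ⟨μ, hμ, hreg, hinv⟩ := hH (ChoiceSpace X)
  let e : ChoiceSpace X → α := fun f => ⟨f.1 ⟨α, hα, hne⟩, f.2 ⟨α, hα, hne⟩⟩
  have he : Continuous e :=
    Continuous.subtype_mk ((continuous_apply _).comp continuous_subtype_val) _
  have hprob : IsProbabilityMeasure (μ.map e) :=
    Measure.isProbabilityMeasure_map he.measurable.aemeasurable
  have hinner : (μ.map e).InnerRegular := Measure.InnerRegular.map_of_continuous he
  refine ⟨μ.map e, hprob, inferInstance, ⟨fun h s hs => ?_⟩⟩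
  have hcont : Continuous fun x : α => h • x :=
    Continuous.subtype_mk (continuous_subtype_val.const_smul ((h : H.toSubgroup) : G)) _
  rw [Measure.map_apply he.measurable (hcont.measurable hs), Measure.map_apply he.measurable hs,
    ← hinv.measure_preimage_smul (h : H.toSubgroup) (he.measurable hs)]
  congr 1
  have heq : ∀ f : ChoiceSpace X, e ((h : H.toSubgroup) • f) = h • e f := by
    intro f
    refine Subtype.ext ?_
    change ((h : H.toSubgroup) : G) • f.1 (((h : H.toSubgroup) : G)⁻¹ • ⟨α, hα, hne⟩) =
      ((h : H.toSubgroup) : G) • f.1 ⟨α, hα, hne⟩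
    have hst : ((h : H.toSubgroup) : G) • α = α := h.2
    have hfix : ((h : H.toSubgroup) : G)⁻¹ •
        (⟨α, hα, hne⟩ : {γ : Set X // IsClopen γ ∧ γ.Nonempty}) = ⟨α, hα, hne⟩ := Subtype.ext (inv_smul_eq_iff.2 hst.symm)
    rw [hfix]
  ext f
  simp only [mem_preimage, heq]

end TDLC

theorem mainTheorem2
    (G : Type u) [Group G] [TopologicalSpace G] [IsTopologicalGroup G]
    [LocallyCompactSpace G] [TotallyDisconnectedSpace G]
    (X : Type v) [TopologicalSpace X] [CompactSpace X] [T2Space X] [TotallyDisconnectedSpace X]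
    [MeasurableSpace X] [BorelSpace X]
    [MulAction G X] [ContinuousSMul G X] [FaithfulSMul G X]
    (hX : TDLC.IsPiecewiseMinimalStronglyProximal G X) :
    (∀ H ∈ TDLC.classS G X, ¬ TDLC.IsConfined H) ∧
      ∀ H : ClosedSubgroup G, TDLC.IsRelativelyAmenable.{u, v} H → H ∈ TDLC.classS G X :=
  ⟨fun _ hH => TDLC.not_isConfined_of_mem_classS hX hH, fun _ hH => hH.mem_classS⟩
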